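/- Let $\mathcal U,\mathcal X_+,\mathcal X_-$ be complex Hilbert spaces; "operator" means bounded linear operator, "invertible" means boundedly invertible, $\mathbb T$ and $\mathbb D$ are the unit circle and the open unit disc, and an operator is called exponentially stable if its spectrum is contained in $\mathbb D$. Let $R$ be a $\mathcal B(\mathcal U)$-valued function that is analytic with invertible values in an open neighborhood of $\mathbb T$ and that has a stable representation there, i.e. $$R(z)=\delta+z\gamma_+(I-z\alpha_+)^{-1}\beta_++\gamma_-(zI-\alpha_-)^{-1}\beta_-$$ near $\mathbb T$, with operators $\delta\in\mathcal B(\mathcal U)$, $\alpha_\pm\in\mathcal B(\mathcal X_\pm)$, $\beta_\pm\in\mathcal B(\mathcal U,\mathcal X_\pm)$, $\gamma_\pm\in\mathcal B(\mathcal X_\pm,\mathcal U)$, where $\alpha_+$ and $\alpha_-$ are exponentially stable. A right canonical Wiener–Hopf factorization of $R$ is a factorization $R(z)=V_-(z)V_+(z)$ near $\mathbb T$, with $\mathcal B(\mathcal U)$-valued functions $V_\pm$ such that $V_+$ is analytic with invertible values on (a neighborhood of) $\overline{\mathbb D}$ with $V_+^{-1}$ also analytic there, and $V_-$ is analytic with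 invertible values on (a neighborhood of) $(\mathbb C\cup\{\infty\})\setminus\mathbb D$ with $V_-^{-1}$ also analytic there. For $Q\in\mathcal B(\mathcal X_+,\mathcal X_-)$ consider the Riccati equation $$Q=\alpha_-Q\alpha_++(\beta_--\alpha_-Q\beta_+)(\delta-\gamma_-Q\beta_+)^{-1}(\gamma_+-\gamma_-Q\alpha_+),\qquad(\ast)$$ a solution being required to have $\delta-\gamma_-Q\beta_+$ invertible. A solution $Q$ is called stabilizing if both $$\alpha_+^\circ:=\alpha_+-\beta_+(\delta-\gamma_-Q\beta_+)^{-1}(\gamma_+-\gamma_-Q\alpha_+),\qquad \alpha_-^\circ:=\alpha_--(\beta_--\alpha_-Q\beta_+)(\delta-\gamma_-Q\beta_+)^{-1}\gamma_-$$ are exponentially stable. Then: (1) $R$ admits a right canonical Wiener–Hopf factorization if and only if $(\ast)$ has a stabilizing solution $Q$. (2) There is at most one stabilizing solution of $(\ast)$. (3) Let $Q$ be a stabilizing solution of $(\ast)$, let $\delta_+,\delta_-\in\mathcal B(\mathcal U)$ be any invertible operators with $\delta_-\delta_+=\delta-\gamma_-Q\beta_+$, and put $\gamma_+^\circ:=\delta_-^{-1}(\gamma_+-\gamma_-Q\alpha_+)$,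 $\beta_-^\circ:=(\beta_--\alpha_-Q\beta_+)\delta_+^{-1}$. Then a right canonical Wiener–Hopf factorization $R(z)=V_-(z)V_+(z)$ is given by $$V_-(z)=\delta_-+\gamma_-(zI-\alpha_-)^{-1}\beta_-^\circ,\qquad V_+(z)=\delta_++z\gamma_+^\circ(I-z\alpha_+)^{-1}\beta_+,$$ and the inverses of the factors are given by $$V_+(z)^{-1}=\delta_+^{-1}-z\delta_+^{-1}\gamma_+^\circ(I-z\alpha_+^\circ)^{-1}\beta_+\delta_+^{-1},$$ $$V_-(z)^{-1}=\delta_-^{-1}-\delta_-^{-1}\gamma_-(zI-\alpha_-^\circ)^{-1}\beta_-^\circ\delta_-^{-1},$$ the first at every $z$ for which $I-z\alpha_+$ and $I-z\alpha_+^\circ$ are invertible, in particular for $|z|\le1$, and the second at every $z$ for which $zI-\alpha_-$ and $zI-\alpha_-^\circ$ are invertible, in particular for $|z|\ge1$. -/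

import Mathlib

open scoped Topology

noncomputable section

/-- `T` is exponentially stable: its spectrum lies in the open unit disc. -/
def ExpStable {X : Type*} [NormedAddCommGroup X] [InnerProductSpace ℂ X] (T : X →L[ℂ] X) : Prop :=
  spectrum ℂ T ⊆ Metric.ball (0 : ℂ) 1

/-- `V` is analytic at the point `∞` of the Riemann sphere, with value `D` there: the function
`w ↦ V (1 / w)`, given the value `D` at `w = 0`, is analytic at `0`. -/
def AnalyticAtInfinity {E : Type*} [NormedAddCommGroup E] [NormedSpace ℂ E]
    (V : ℂ → E) (D : E) : Prop :=
  AnalyticAt ℂ (Function.update (fun w : ℂ => V w⁻¹) 0 D) 0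

/-- `R = Vm Vp` is a right canonical Wiener-Hopf factorization with respect to the unit circle.
All analyticity is in operator norm; `IsUnit` in `U →L[ℂ] U` is bounded invertibility, and
`Ring.inverse` is then the bounded inverse. The exterior domain contains the point `∞`. -/
structure IsRightCanonicalWH {U : Type*} [NormedAddCommGroup U] [InnerProductSpace ℂ U]
    (R Vm Vp : ℂ → (U →L[ℂ] U)) : Prop where
  factor : ∀ᶠ z in 𝓝ˢ (Metric.sphere (0 : ℂ) 1), R z = Vm z * Vp z
  plus_analytic : AnalyticOnNhd ℂ Vp {z | ‖z‖ ≤ 1}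
  plus_isUnit : ∀ z : ℂ, ‖z‖ ≤ 1 → IsUnit (Vp z)
  plus_inv_analytic : AnalyticOnNhd ℂ (fun z => Ring.inverse (Vp z)) {z | ‖z‖ ≤ 1}
  minus_analytic : AnalyticOnNhd ℂ Vm {z | 1 ≤ ‖z‖}
  minus_isUnit : ∀ z : ℂ, 1 ≤ ‖z‖ → IsUnit (Vm z)
  minus_inv_analytic : AnalyticOnNhd ℂ (fun z => Ring.inverse (Vm z)) {z | 1 ≤ ‖z‖}
  minus_infinity : ∃ D : U →L[ℂ] U, IsUnit D ∧ AnalyticAtInfinity Vm D ∧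
    AnalyticAtInfinity (fun z => Ring.inverse (Vm z)) (Ring.inverse D)

/-- The seven bounded operators `δ, γ₊, α₊, β₊, γ₋, α₋, β₋` of a representation
`δ + z γ₊ (I - z α₊)⁻¹ β₊ + γ₋ (z I - α₋)⁻¹ β₋`. -/
structure RepData (U Xp Xm : Type*)
    [NormedAddCommGroup U] [InnerProductSpace ℂ U]
    [NormedAddCommGroup Xp] [InnerProductSpace ℂ Xp]
    [NormedAddCommGroup Xm] [InnerProductSpace ℂ Xm] where
  δ : U →L[ℂ] U
  γp : Xp →L[ℂ] U
  αp : Xp →L[ℂ] Xp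
  βp : U →L[ℂ] Xp
  γm : Xm →L[ℂ] U
  αm : Xm →L[ℂ] Xm
  βm : U →L[ℂ] Xm

namespace RepData

variable {U Xp Xm : Type*}
  [NormedAddCommGroup U] [InnerProductSpace ℂ U]
  [NormedAddCommGroup Xp] [InnerProductSpace ℂ Xp]
  [NormedAddCommGroup Xm] [InnerProductSpace ℂ Xm]

/-- The value `δ + z γ₊ (I - z α₊)⁻¹ β₊ + γ₋ (z I - α₋)⁻¹ β₋`, meaningful where both
inverses exist. -/
def eval (S : RepData U Xp Xm) (z : ℂ) : U →L[ℂ] U :=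
  S.δ + z • (S.γp ∘L Ring.inverse (1 - z • S.αp) ∘L S.βp)
    + S.γm ∘L Ring.inverse (z • 1 - S.αm) ∘L S.βm

/-- `S` is a stable representation of `R`: `α₊`, `α₋` are exponentially stable and `R` is given
by the representation near the unit circle (where both inverses exist). -/
structure IsStableRepOf (S : RepData U Xp Xm) (R : ℂ → (U →L[ℂ] U)) : Prop where
  stable_p : ExpStable S.αp
  stable_m : ExpStable S.αm
  eq_eval : ∀ᶠ z in 𝓝ˢ (Metric.sphere (0 : ℂ) 1), R z = S.eval z

/-- `δ - γ₋ Q β₊`. -/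
def pivot (S : RepData U Xp Xm) (Q : Xp →L[ℂ] Xm) : U →L[ℂ] U :=
  S.δ - S.γm ∘L Q ∘L S.βp

/-- `γ₊ - γ₋ Q α₊`. -/
def gq (S : RepData U Xp Xm) (Q : Xp →L[ℂ] Xm) : Xp →L[ℂ] U :=
  S.γp - S.γm ∘L Q ∘L S.αp

/-- `β₋ - α₋ Q β₊`. -/
def bq (S : RepData U Xp Xm) (Q : Xp →L[ℂ] Xm) : U →L[ℂ] Xm :=
  S.βm - S.αm ∘L Q ∘L S.βp

/-- The Riccati equation
`Q = α₋ Q α₊ + (β₋ - α₋ Q β₊) (δ - γ₋ Q β₊)⁻¹ (γ₊ - γ₋ Q α₊)`,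
including the requirement that `δ - γ₋ Q β₊` is boundedly invertible. -/
structure SolvesRiccati (S : RepData U Xp Xm) (Q : Xp →L[ℂ] Xm) : Prop where
  isUnit_pivot : IsUnit (S.pivot Q)
  eqn : Q = S.αm ∘L Q ∘L S.αp + S.bq Q ∘L Ring.inverse (S.pivot Q) ∘L S.gq Q

/-- `α₊° = α₊ - β₊ (δ - γ₋ Q β₊)⁻¹ (γ₊ - γ₋ Q α₊)`. -/
def αpCirc (S : RepData U Xp Xm) (Q : Xp →L[ℂ] Xm) : Xp →L[ℂ] Xp :=
  S.αp - S.βp ∘L Ring.inverse (S.pivot Q) ∘L S.gq Q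

/-- `α₋° = α₋ - (β₋ - α₋ Q β₊) (δ - γ₋ Q β₊)⁻¹ γ₋`. -/
def αmCirc (S : RepData U Xp Xm) (Q : Xp →L[ℂ] Xm) : Xm →L[ℂ] Xm :=
  S.αm - S.bq Q ∘L Ring.inverse (S.pivot Q) ∘L S.γm

/-- `Q` is a stabilizing solution of the Riccati equation. -/
structure IsStabilizing (S : RepData U Xp Xm) (Q : Xp →L[ℂ] Xm) : Prop
    extends S.SolvesRiccati Q where
  stable_p : ExpStable (S.αpCirc Q)
  stable_m : ExpStable (S.αmCirc Q)

/-- `γ₊° = δ₋⁻¹ (γ₊ - γ₋ Q α₊)`. -/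
def γpCirc (S : RepData U Xp Xm) (Q : Xp →L[ℂ] Xm) (δm : U →L[ℂ] U) : Xp →L[ℂ] U :=
  Ring.inverse δm ∘L S.gq Q

/-- `β₋° = (β₋ - α₋ Q β₊) δ₊⁻¹`. -/
def βmCirc (S : RepData U Xp Xm) (Q : Xp →L[ℂ] Xm) (δp : U →L[ℂ] U) : U →L[ℂ] Xm :=
  S.bq Q ∘L Ring.inverse δp

/-- `V₋(z) = δ₋ + γ₋ (z I - α₋)⁻¹ β₋°`. -/
def Vm (S : RepData U Xp Xm) (Q : Xp →L[ℂ] Xm) (δm δp : U →L[ℂ] U) (z : ℂ) : U →L[ℂ] U :=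
  δm + S.γm ∘L Ring.inverse (z • 1 - S.αm) ∘L S.βmCirc Q δp

/-- `V₊(z) = δ₊ + z γ₊° (I - z α₊)⁻¹ β₊`. -/
def Vp (S : RepData U Xp Xm) (Q : Xp →L[ℂ] Xm) (δm δp : U →L[ℂ] U) (z : ℂ) : U →L[ℂ] U :=
  δp + z • (S.γpCirc Q δm ∘L Ring.inverse (1 - z • S.αp) ∘L S.βp)

/-- `δ₊⁻¹ - z δ₊⁻¹ γ₊° (I - z α₊°)⁻¹ β₊ δ₊⁻¹`. -/
def VpInv (S : RepData U Xp Xm) (Q : Xp →L[ℂ] Xm) (δm δp : U →L[ℂ] U) (z : ℂ) : U →L[ℂ] U :=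
  Ring.inverse δp - z • (Ring.inverse δp ∘L S.γpCirc Q δm ∘L
    Ring.inverse (1 - z • S.αpCirc Q) ∘L S.βp ∘L Ring.inverse δp)

/-- `δ₋⁻¹ - δ₋⁻¹ γ₋ (z I - α₋°)⁻¹ β₋° δ₋⁻¹`. -/
def VmInv (S : RepData U Xp Xm) (Q : Xp →L[ℂ] Xm) (δm δp : U →L[ℂ] U) (z : ℂ) : U →L[ℂ] U :=
  Ring.inverse δm - Ring.inverse δm ∘L S.γm ∘L
    Ring.inverse (z • 1 - S.αmCirc Q) ∘L S.βmCirc Q δp ∘L Ring.inverse δm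

end RepData

end

/-!
The link between factorizations and the Riccati equation is the Stein equation
`Q = α₋ Q α₊ + B C`. It gives the partial fraction identity
`z (z - α₋)⁻¹ B C (1 - z α₊)⁻¹ = Q (1 - z α₊)⁻¹ + (z - α₋)⁻¹ α₋ Q`, so the product of
`δ₋ + γ₋ (z - α₋)⁻¹ B` and `δ₊ + z C (1 - z α₊)⁻¹ β₊` is given by the representation with
coefficients `δ = δ₋ δ₊ + γ₋ Q β₊`, `γ₊ = δ₋ C + γ₋ Q α₊`, `β₋ = B δ₊ + α₋ Q β₊` (`mul_eq_eval`).
With these relations the Stein equation is the Riccati equation (`solvesRiccati_iff_stein`), and by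
Schur complements (`isUnit_add_comp_inverse`) the factors are invertible exactly where
`1 - z α₊°` and `z - α₋°` are, wherever their defining formulas make sense. Hence a
stabilizing solution gives a canonical factorization.

For the converse no minimality of the representation is available, so the coefficients `B` and `C`
have to be produced from the factors. They are obtained by division with remainder
(`exists_eq_add_sub_apply`): if `α` is exponentially stable and `G` is analytic on the closed disc,
then `G(w) γ = C + H(w) (w - α)` with `H` analytic on the closed disc and a unique constant `C`;
both are Cauchy integrals. Apply this to `V₋(1 / w)⁻¹ γ₊` with `α₊`, and on the other side to
`β₋ V₊(z)⁻¹` with `α₋`. The equation `V₊ = V₋⁻¹ R` then shows that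
`V₊(z) - z C (1 - z α₊)⁻¹ β₊` extends analytically to the whole Riemann sphere, hence is constant
by Liouville's theorem (`eq_const_of_eqOn_circle`, `plus_factor_eq`), and likewise for `V₋`. With
`Q` the solution of the Stein equation, uniqueness of remainders gives the relations for `γ₊` and
`β₋` as operator identities (`minus_value_comp`, `comp_plus_value`), and evaluating
`R = V₋ V₊` at one point gives the relation for `δ`. The Stein equation itself is solved by the same
division (`exists_stein`).

Uniqueness of the stabilizing solution follows from the identity
`Q - Q' = α₋°(Q) (Q - Q') α₊°(Q')` and the uniqueness for the Stein equation.
-/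

namespace WienerHopf

/-! ### Analyticity of operator-valued functions -/

section Analytic

variable {E F G : Type*} [NormedAddCommGroup E] [NormedSpace ℂ E]
  [NormedAddCommGroup F] [NormedSpace ℂ F] [NormedAddCommGroup G] [NormedSpace ℂ G]

theorem analyticAt_clm_comp {f : ℂ → F →L[ℂ] G} {g : ℂ → E →L[ℂ] F} {z : ℂ}
    (hf : AnalyticAt ℂ f z) (hg : AnalyticAt ℂ g z) :
    AnalyticAt ℂ (fun w => f w ∘L g w) z :=
  ((ContinuousLinearMap.compL ℂ E F G).analyticAt_bilinear (f z, g z)).comp₂ hf hg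

theorem analyticAt_clm_apply {f : ℂ → E →L[ℂ] F} {g : ℂ → E} {z : ℂ}
    (hf : AnalyticAt ℂ f z) (hg : AnalyticAt ℂ g z) :
    AnalyticAt ℂ (fun w => f w (g w)) z :=
  ((ContinuousLinearMap.id ℂ (E →L[ℂ] F)).analyticAt_bilinear (f z, g z)).comp₂ hf hg

variable [CompleteSpace E]

theorem analyticAt_ringInverse {f : ℂ → E →L[ℂ] E} {z : ℂ}
    (hf : AnalyticAt ℂ f z) (hu : IsUnit (f z)) :
    AnalyticAt ℂ (fun w => Ring.inverse (f w)) z :=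
  AnalyticAt.comp (g := Ring.inverse) (analyticAt_inverse hu.unit) hf

theorem analyticAt_inverse_one_sub_smul (T : E →L[ℂ] E) {z : ℂ} (hu : IsUnit (1 - z • T)) :
    AnalyticAt ℂ (fun w : ℂ => Ring.inverse (1 - w • T)) z :=
  analyticAt_ringInverse (by fun_prop) hu

theorem analyticAt_inverse_smul_one_sub (T : E →L[ℂ] E) {z : ℂ} (hu : IsUnit (z • 1 - T)) :
    AnalyticAt ℂ (fun w : ℂ => Ring.inverse (w • 1 - T)) z :=
  analyticAt_ringInverse (by fun_prop) hu

theorem eventually_isUnit {f : ℂ → E →L[ℂ] E} {z : ℂ}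
    (hf : ContinuousAt f z) (hu : IsUnit (f z)) : ∀ᶠ w in 𝓝 z, IsUnit (f w) :=
  hf.eventually (Units.isOpen.mem_nhds hu)

end Analytic

/-! ### Gluing across the unit circle -/

/-- Liouville's theorem on the Riemann sphere: if `f` is analytic on the closed unit disc and
`z ↦ g (1 / z)` on its closed exterior, including `∞`, and the two agree on the unit circle, then
both are constant. -/
theorem eq_const_of_eqOn_circle {E : Type*} [NormedAddCommGroup E] [NormedSpace ℂ E]
    {f g : ℂ → E} (hf : AnalyticOnNhd ℂ f {z | ‖z‖ ≤ 1}) (hg : AnalyticOnNhd ℂ g {z | ‖z‖ ≤ 1})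
    (h : ∀ z : ℂ, ‖z‖ = 1 → f z = g z⁻¹) :
    (∀ z : ℂ, ‖z‖ ≤ 1 → f z = f 0) ∧ (∀ z : ℂ, ‖z‖ ≤ 1 → g z = f 0) := by
  classical
  have hinv : ∀ z : ℂ, 1 ≤ ‖z‖ → AnalyticAt ℂ (fun w : ℂ => g w⁻¹) z := by
    intro z hz
    have hz0 : z ≠ 0 := by rintro rfl; norm_num at hz
    have h1 : ‖z⁻¹‖ ≤ 1 := by rw [norm_inv]; exact inv_le_one_of_one_le₀ hz
    exact AnalyticAt.fun_comp (g := g) (hg _ h1) (analyticAt_inv hz0)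
  -- On the circle the two functions agree on a set that accumulates at each of its points.
  have hloc : ∀ z : ℂ, ‖z‖ = 1 → ∀ᶠ w in 𝓝 z, f w = g w⁻¹ := by
    intro z hz
    rw [← AnalyticAt.frequently_eq_iff_eventually_eq (hf z hz.le) (hinv z hz.ge)]
    have hnt : (Metric.sphere (0 : ℂ) 1).Nontrivial := ⟨1, by simp, -1, by simp, by
      intro h; norm_num [Complex.ext_iff] at h⟩
    have hacc := IsPreconnected.preperfect_of_nontrivial hnt
      (isPreconnected_sphere (by simp [Complex.rank_real_complex]) (0 : ℂ) 1) z (by simpa using hz)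
    rw [accPt_iff_frequently_nhdsNE] at hacc
    exact hacc.mono fun w hw => h w (by simpa using hw)
  let F : ℂ → E := fun z => if ‖z‖ ≤ 1 then f z else g z⁻¹
  have hF : Differentiable ℂ F := by
    intro z
    rcases lt_trichotomy ‖z‖ 1 with hz | hz | hz
    · refine (hf z hz.le).differentiableAt.congr_of_eventuallyEq ?_
      filter_upwards [continuous_norm.continuousAt.eventually_lt_const hz] with w hw
      simp only [F, if_pos hw.le]
    · refine (hf z hz.le).differentiableAt.congr_of_eventuallyEq ?_
      filter_upwards [hloc z hz] with w hw
      simp only [F]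
      split_ifs
      · rfl
      · exact hw.symm
    · refine (hinv z hz.le).differentiableAt.congr_of_eventuallyEq ?_
      filter_upwards [continuous_norm.continuousAt.eventually_const_lt hz] with w hw
      simp only [F, if_neg (not_le.2 hw)]
  have hball : {z : ℂ | ‖z‖ ≤ 1} = Metric.closedBall 0 1 := by ext; simp
  have hcpt : IsCompact {z : ℂ | ‖z‖ ≤ 1} := hball ▸ isCompact_closedBall 0 1
  have hbdd : Bornology.IsBounded (Set.range F) := by
    refine ((hcpt.image_of_continuousOn hf.continuousOn).isBounded.union
      (hcpt.image_of_continuousOn hg.continuousOn).isBounded).subset ?_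
    rintro _ ⟨z, rfl⟩
    by_cases hz : ‖z‖ ≤ 1
    · exact Or.inl ⟨z, hz, by simp only [F, if_pos hz]⟩
    · refine Or.inr ⟨z⁻¹, ?_, by simp only [F, if_neg hz]⟩
      simpa [norm_inv] using inv_le_one_of_one_le₀ (not_le.1 hz).le
  have hconst := hF.apply_eq_apply_of_bounded hbdd
  have hfc : ∀ z : ℂ, ‖z‖ ≤ 1 → f z = f 0 := by
    intro z hz
    simpa [F, hz] using hconst z 0
  have hgc : ∀ z : ℂ, ‖z‖ ≤ 1 → z ≠ 0 → g z = f 0 := by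
    intro z hz hz0
    rcases hz.lt_or_eq with h1 | h1
    · have h2 : ¬ ‖z⁻¹‖ ≤ 1 := by
        rw [norm_inv, not_le]
        exact (one_lt_inv₀ (norm_pos_iff.2 hz0)).2 h1
      have := hconst z⁻¹ 0
      simpa only [F, if_neg h2, inv_inv, norm_zero, zero_le_one, if_true] using this
    · have h2 : ‖z⁻¹‖ = 1 := by rw [norm_inv, h1, inv_one]
      rw [← hfc z⁻¹ h2.le, h _ h2, inv_inv]
  refine ⟨hfc, fun z hz => ?_⟩
  by_cases hz0 : z = 0
  · subst hz0
    have h1 : Filter.Tendsto g (𝓝[≠] 0) (𝓝 (g 0)) :=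
      (hg 0 (by simp)).continuousAt.mono_left nhdsWithin_le_nhds
    refine tendsto_nhds_unique h1 (tendsto_const_nhds.congr' ?_)
    filter_upwards [self_mem_nhdsWithin, nhdsWithin_le_nhds (Metric.ball_mem_nhds (0 : ℂ) one_pos)]
      with w hw hw1
    exact (hgc w (by simpa using (mem_ball_zero_iff.1 hw1).le) hw).symm
  · exact hgc z hz hz0

/-! ### Evaluation of an analytic function at an operator -/

section Evaluation

variable {E : Type*} [NormedAddCommGroup E] [NormedSpace ℂ E] [CompleteSpace E]

theorem clm_circleIntegral {F : Type*} [NormedAddCommGroup F] [NormedSpace ℂ F] [CompleteSpace F]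
    (L : E →L[ℂ] F) {f : ℂ → E} {c : ℂ} {r : ℝ} (hf : CircleIntegrable f c r) :
    L (∮ z in C(c, r), f z) = ∮ z in C(c, r), L (f z) := by
  simp only [circleIntegral]
  rw [← ContinuousLinearMap.intervalIntegral_comp_comm L hf.out]
  simp

/-- Division with remainder by `w - T`, where the spectrum of `T` lies in the open unit disc: a
function `G` analytic on the closed unit disc is `C + (w - T) H(w)` with a constant `C`, the value
of `G` at `T`, and `H` analytic on the closed disc. Both are Cauchy integrals of `(s - T)⁻¹ G(s)`
over a slightly larger circle. -/
theorem exists_eq_add_sub_apply {G : ℂ → E} (hG : AnalyticOnNhd ℂ G {z | ‖z‖ ≤ 1})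
    {T : E →L[ℂ] E} (hT : ∀ s : ℂ, 1 ≤ ‖s‖ → IsUnit (s • 1 - T)) :
    ∃ (C : E) (H : ℂ → E), AnalyticOnNhd ℂ H {z | ‖z‖ ≤ 1} ∧
      ∀ w : ℂ, ‖w‖ ≤ 1 → G w = C + (w • H w - T (H w)) := by
  have hball : {z : ℂ | ‖z‖ ≤ 1} = Metric.closedBall 0 1 := by ext; simp
  obtain ⟨ε, hε, hsub⟩ := (isCompact_closedBall (0 : ℂ) 1).exists_cthickening_subset_open
    (isOpen_analyticAt ℂ G) (fun z hz => hG z (by simpa using hz))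
  rw [cthickening_closedBall hε.le zero_le_one] at hsub
  obtain ⟨ρ, hρ⟩ : ∃ ρ : NNReal, (ρ : ℝ) = ε + 1 := ⟨⟨ε + 1, by positivity⟩, rfl⟩
  rw [← hρ] at hsub
  have hρ1 : (1 : ℝ) < ρ := by linarith
  have hρ0 : 0 < ρ := NNReal.coe_pos.1 (by linarith)
  have hGan : ∀ z ∈ Metric.closedBall (0 : ℂ) ρ, AnalyticAt ℂ G z := fun z hz => hsub hz
  let F : ℂ → E := fun s => Ring.inverse (s • 1 - T) (G s)
  have hsph : ∀ s ∈ Metric.sphere (0 : ℂ) ρ, IsUnit (s • 1 - T) := fun s hs =>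
    hT s (by rw [mem_sphere_zero_iff_norm.1 hs]; exact hρ1.le)
  have hFc : ContinuousOn F (Metric.sphere (0 : ℂ) ρ) := fun s hs =>
    (analyticAt_clm_apply (analyticAt_inverse_smul_one_sub T (hsph s hs))
      (hGan s (Metric.sphere_subset_closedBall hs))).continuousAt.continuousWithinAt
  have hFi : CircleIntegrable F 0 ρ := hFc.circleIntegrable ρ.coe_nonneg
  let k : ℂ := (2 * Real.pi * Complex.I)⁻¹
  refine ⟨k • ∮ s in C(0, ρ), F s, fun w => k • ∮ s in C(0, ρ), (s - w)⁻¹ • F s, ?_, ?_⟩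
  · intro w hw
    refine (hasFPowerSeriesOn_cauchy_integral hFi hρ0).analyticAt_of_mem ?_
    rw [Metric.mem_eball, edist_zero_right, enorm_eq_nnnorm, ENNReal.coe_lt_coe,
      ← NNReal.coe_lt_coe, coe_nnnorm]
    exact lt_of_le_of_lt hw hρ1
  · intro w hw
    have hwρ : ‖w‖ < ρ := lt_of_le_of_lt hw hρ1
    have hne : ∀ s ∈ Metric.sphere (0 : ℂ) ρ, s - w ≠ 0 := by
      intro s hs h0
      rw [sub_eq_zero.1 h0] at hs
      exact hwρ.ne (mem_sphere_zero_iff_norm.1 hs)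
    have hinvc : ContinuousOn (fun s : ℂ => (s - w)⁻¹) (Metric.sphere (0 : ℂ) ρ) :=
      (continuousOn_id.sub continuousOn_const).inv₀ hne
    have hi1 : CircleIntegrable (fun s => (s - w)⁻¹ • F s) 0 ρ :=
      (hinvc.smul hFc).circleIntegrable ρ.coe_nonneg
    have hi2 : CircleIntegrable (fun s => (s - w)⁻¹ • G s) 0 ρ :=
      (hinvc.smul fun s hs => (hGan s
        (Metric.sphere_subset_closedBall hs)).continuousAt.continuousWithinAt).circleIntegrable
        ρ.coe_nonneg
    have hcauchy : k • ∮ s in C(0, ρ), (s - w)⁻¹ • G s = G w :=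
      Complex.two_pi_I_inv_smul_circleIntegral_sub_inv_smul_of_differentiable_on_off_countable
        Set.countable_empty (by simpa using hwρ)
        (fun s hs => (hGan s hs).continuousAt.continuousWithinAt)
        (fun s hs => (hGan s (Metric.ball_subset_closedBall hs.1)).differentiableAt)
    have key : (w • 1 - T) (∮ s in C(0, ρ), (s - w)⁻¹ • F s)
        = (∮ s in C(0, ρ), (s - w)⁻¹ • G s) - ∮ s in C(0, ρ), F s := by
      rw [clm_circleIntegral _ hi1, ← circleIntegral.integral_sub hi2 hFi]
      refine circleIntegral.integral_congr ρ.coe_nonneg fun s hs => ?_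
      have hres : s • F s - T (F s) = G s := by
        have := congrArg (fun A : E →L[ℂ] E => A (G s)) (Ring.mul_inverse_cancel _ (hsph s hs))
        simpa [F] using this
      have hTF : T (F s) = s • F s - G s := by rw [← hres]; abel
      -- `w - T = (s - T) - (s - w)`.
      have h2 : w • F s - T (F s) = G s - (s - w) • F s := by rw [hTF, sub_smul]; abel
      simp only [map_smul, sub_apply, smul_apply,
        one_apply_eq_self, h2]
      rw [smul_sub, inv_smul_smul₀ (hne s hs)]
    have : w • (k • ∮ s in C(0, ρ), (s - w)⁻¹ • F s) - T (k • ∮ s in C(0, ρ), (s - w)⁻¹ • F s)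
        = k • (w • 1 - T) (∮ s in C(0, ρ), (s - w)⁻¹ • F s) := by
      simp [smul_sub, smul_comm w k]
    rw [this, key, smul_sub, hcauchy]
    abel

/-- The remainder in the division by `w - T` is unique. -/
theorem eq_zero_of_eq_sub_apply {C : E} {H : ℂ → E} (hH : AnalyticOnNhd ℂ H {z | ‖z‖ ≤ 1})
    {T : E →L[ℂ] E} (hT : ∀ s : ℂ, ‖s‖ ≤ 1 → IsUnit (1 - s • T))
    (h : ∀ w : ℂ, ‖w‖ = 1 → C = w • H w - T (H w)) : C = 0 := by
  -- `H(w) = (w - T)⁻¹ C` on the circle, and the right-hand side vanishes at infinity.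
  have hg : AnalyticOnNhd ℂ (fun z : ℂ => z • Ring.inverse (1 - z • T) C) {z | ‖z‖ ≤ 1} :=
    fun z hz => analyticAt_id.smul
      (analyticAt_clm_apply (analyticAt_inverse_one_sub_smul T (hT z hz)) analyticAt_const)
  have hcirc : ∀ w : ℂ, ‖w‖ = 1 → H w = w⁻¹ • Ring.inverse (1 - w⁻¹ • T) C := by
    intro w hw
    have hw0 : w ≠ 0 := by rintro rfl; norm_num at hw
    have h1 : C = w • (1 - w⁻¹ • T) (H w) := by
      rw [h w hw]
      simp [smul_sub, hw0]
    have h2 := congrArg (fun A : E →L[ℂ] E => A (H w))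
      (Ring.inverse_mul_cancel _ (hT w⁻¹ (by rw [norm_inv, hw, inv_one])))
    simp only [mul_apply_eq_comp, one_apply_eq_self] at h2
    conv_rhs => rw [h1, map_smul, h2, inv_smul_smul₀ hw0]
  obtain ⟨h1, h2⟩ := eq_const_of_eqOn_circle hH hg hcirc
  have h0 : H 1 = 0 := by
    rw [h1 1 (by simp), ← h2 0 (by simp), zero_smul]
  rw [h 1 (by simp), h0]
  simp

end Evaluation

/-! ### Exponentially stable operators -/

section Stable

variable {X : Type*} [NormedAddCommGroup X] [InnerProductSpace ℂ X] {T : X →L[ℂ] X}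

theorem one_sub_smul_eq {z : ℂ} (hz : z ≠ 0) : 1 - z • T = z • (z⁻¹ • 1 - T) := by
  rw [smul_sub, smul_inv_smul₀ hz]

theorem isUnit_one_sub_smul_iff {z : ℂ} (hz : z ≠ 0) :
    IsUnit (1 - z • T) ↔ IsUnit (z⁻¹ • 1 - T) := by
  rw [one_sub_smul_eq hz]
  exact isUnit_smul_iff (Units.mk0 z hz) _

theorem expStable_iff : ExpStable T ↔ ∀ z : ℂ, 1 ≤ ‖z‖ → IsUnit (z • 1 - T) := by
  refine ⟨fun h z hz => ?_, fun h z hz => ?_⟩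
  · by_contra hn
    have : z ∈ spectrum ℂ T := by
      rw [spectrum.mem_iff, Algebra.algebraMap_eq_smul_one]
      exact hn
    exact absurd (mem_ball_zero_iff.1 (h this)) (not_lt.2 hz)
  · rw [mem_ball_zero_iff]
    by_contra hn
    rw [spectrum.mem_iff, Algebra.algebraMap_eq_smul_one] at hz
    exact hz (h z (not_lt.1 hn))

theorem expStable_iff_one_sub : ExpStable T ↔ ∀ z : ℂ, ‖z‖ ≤ 1 → IsUnit (1 - z • T) := by
  rw [expStable_iff]
  refine ⟨fun h z hz => ?_, fun h z hz => ?_⟩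
  · rcases eq_or_ne z 0 with rfl | hz0
    · simp
    · rw [isUnit_one_sub_smul_iff hz0]
      exact h _ (by rw [norm_inv]; exact (one_le_inv₀ (norm_pos_iff.2 hz0)).2 hz)
  · have hz0 : z ≠ 0 := by rintro rfl; norm_num at hz
    have := (isUnit_one_sub_smul_iff (inv_ne_zero hz0)).1
      (h z⁻¹ (by rw [norm_inv]; exact inv_le_one_of_one_le₀ hz))
    rwa [inv_inv] at this

end Stable

/-! ### Schur complements -/

section Algebra

theorem inverse_eq_of_mul_eq_one {A : Type*} [Ring A] {a b : A} (h1 : a * b = 1) (h2 : b * a = 1) :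
    IsUnit a ∧ Ring.inverse a = b :=
  ⟨⟨⟨a, b, h1, h2⟩, rfl⟩, Ring.inverse_unit ⟨a, b, h1, h2⟩⟩

theorem apply_inverse_apply {X : Type*} [NormedAddCommGroup X] [NormedSpace ℂ X]
    {a : X →L[ℂ] X} (ha : IsUnit a) (x : X) : a (Ring.inverse a x) = x := by
  simpa using congrArg (fun A : X →L[ℂ] X => A x) (Ring.mul_inverse_cancel _ ha)

theorem inverse_apply_apply {X : Type*} [NormedAddCommGroup X] [NormedSpace ℂ X]
    {a : X →L[ℂ] X} (ha : IsUnit a) (x : X) : Ring.inverse a (a x) = x := by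
  simpa using congrArg (fun A : X →L[ℂ] X => A x) (Ring.inverse_mul_cancel _ ha)

theorem inverse_smul_one_sub {X : Type*} [NormedAddCommGroup X] [NormedSpace ℂ X]
    {T : X →L[ℂ] X} {z : ℂ} (hz : z ≠ 0) (hu : IsUnit (1 - z⁻¹ • T)) :
    Ring.inverse (z • 1 - T) = z⁻¹ • Ring.inverse (1 - z⁻¹ • T) := by
  have h : z • 1 - T = z • (1 - z⁻¹ • T) := by rw [smul_sub, smul_inv_smul₀ hz]
  refine (inverse_eq_of_mul_eq_one ?_ ?_).2
  · rw [h, smul_mul_smul_comm, mul_inv_cancel₀ hz, one_smul, Ring.mul_inverse_cancel _ hu]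
  · rw [h, smul_mul_smul_comm, inv_mul_cancel₀ hz, one_smul, Ring.inverse_mul_cancel _ hu]

variable {U X : Type*} [NormedAddCommGroup U] [NormedSpace ℂ U]
  [NormedAddCommGroup X] [NormedSpace ℂ X]

/-- The two Schur complements of an operator matrix with diagonal entries `a` and `d` are
simultaneously invertible, and the inverse of one is given by the inverse of the other. -/
theorem isUnit_add_comp_inverse {a : X →L[ℂ] X} {d : U →L[ℂ] U} {b : U →L[ℂ] X} {c : X →L[ℂ] U}
    (ha : IsUnit a) (hd : IsUnit d) (hs : IsUnit (a + b ∘L Ring.inverse d ∘L c)) :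
    IsUnit (d + c ∘L Ring.inverse a ∘L b) ∧
      Ring.inverse (d + c ∘L Ring.inverse a ∘L b) = Ring.inverse d -
        Ring.inverse d ∘L c ∘L Ring.inverse (a + b ∘L Ring.inverse d ∘L c) ∘L b ∘L
          Ring.inverse d := by
  refine inverse_eq_of_mul_eq_one ?_ ?_
  · ext x
    have hy := apply_inverse_apply hs (b (Ring.inverse d x))
    set y := Ring.inverse (a + b ∘L Ring.inverse d ∘L c) (b (Ring.inverse d x)) with hy_def
    simp only [add_apply, ContinuousLinearMap.comp_apply] at hy
    have h1 : b (Ring.inverse d (c y)) = b (Ring.inverse d x) - a y := by rw [← hy]; abel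
    simp only [mul_apply_eq_comp, add_apply, sub_apply, ContinuousLinearMap.comp_apply,
      ← hy_def, map_sub, h1, apply_inverse_apply hd, inverse_apply_apply ha, one_apply_eq_self]
    abel
  · ext x
    have hu := apply_inverse_apply ha (b x)
    set u := Ring.inverse a (b x) with hu_def
    have hx := inverse_apply_apply hd x
    have h1 : b (Ring.inverse d (d x + c u)) = (a + b ∘L Ring.inverse d ∘L c) u := by
      simp [hx, hu]
    have h2 : Ring.inverse (a + b ∘L Ring.inverse d ∘L c) (b (Ring.inverse d (d x + c u))) = u := by
      rw [h1, inverse_apply_apply hs]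
    simp only [mul_apply_eq_comp, add_apply, sub_apply, ContinuousLinearMap.comp_apply,
      ← hu_def, h2, one_apply_eq_self]
    rw [map_add, hx]
    abel

end Algebra

/-! ### Operator-valued division and the Stein equation -/

section Division

variable {U X Y : Type*} [NormedAddCommGroup U] [NormedSpace ℂ U]
  [NormedAddCommGroup X] [InnerProductSpace ℂ X]
  [NormedAddCommGroup Y] [InnerProductSpace ℂ Y]

theorem isUnit_compL_flip {a : X →L[ℂ] X} (ha : IsUnit a) :
    IsUnit ((ContinuousLinearMap.compL ℂ X X U).flip a) := by
  refine (inverse_eq_of_mul_eq_one (b := (ContinuousLinearMap.compL ℂ X X U).flip (Ring.inverse a))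
    ?_ ?_).1
  · ext A x
    simp [inverse_apply_apply ha]
  · ext A x
    simp [apply_inverse_apply ha]

theorem isUnit_compL {a : Y →L[ℂ] Y} (ha : IsUnit a) :
    IsUnit (ContinuousLinearMap.compL ℂ U Y Y a) := by
  refine (inverse_eq_of_mul_eq_one (b := ContinuousLinearMap.compL ℂ U Y Y (Ring.inverse a))
    ?_ ?_).1
  · ext A x
    simp [apply_inverse_apply ha]
  · ext A x
    simp [inverse_apply_apply ha]

section

variable [CompleteSpace U]

/-- Right division with remainder: `G(w) = C + H(w) (w - α)`. -/
theorem exists_eq_add_comp_sub {G : ℂ → X →L[ℂ] U} (hG : AnalyticOnNhd ℂ G {z | ‖z‖ ≤ 1})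
    {α : X →L[ℂ] X} (hα : ExpStable α) :
    ∃ (C : X →L[ℂ] U) (H : ℂ → X →L[ℂ] U), AnalyticOnNhd ℂ H {z | ‖z‖ ≤ 1} ∧
      ∀ w : ℂ, ‖w‖ ≤ 1 → G w = C + H w ∘L (w • 1 - α) := by
  obtain ⟨C, H, hH, h⟩ := exists_eq_add_sub_apply hG
    (T := (ContinuousLinearMap.compL ℂ X X U).flip α) (fun s hs => by
      convert isUnit_compL_flip (U := U) (expStable_iff.1 hα s hs) using 1
      ext A x
      simp)
  refine ⟨C, H, hH, fun w hw => (h w hw).trans ?_⟩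
  ext x
  simp

theorem eq_zero_of_eq_comp_sub {C : X →L[ℂ] U} {H : ℂ → X →L[ℂ] U}
    (hH : AnalyticOnNhd ℂ H {z | ‖z‖ ≤ 1}) {α : X →L[ℂ] X} (hα : ExpStable α)
    (h : ∀ w : ℂ, ‖w‖ = 1 → C = H w ∘L (w • 1 - α)) : C = 0 := by
  refine eq_zero_of_eq_sub_apply hH (T := (ContinuousLinearMap.compL ℂ X X U).flip α)
    (fun s hs => ?_) (fun w hw => (h w hw).trans ?_)
  · convert isUnit_compL_flip (U := U) (expStable_iff_one_sub.1 hα s hs) using 1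
    ext A x
    simp
  · ext x
    simp

end

variable [CompleteSpace Y]

/-- Left division with remainder: `G(w) = C + (w - α) H(w)`. -/
theorem exists_eq_add_sub_comp {G : ℂ → U →L[ℂ] Y} (hG : AnalyticOnNhd ℂ G {z | ‖z‖ ≤ 1})
    {α : Y →L[ℂ] Y} (hα : ExpStable α) :
    ∃ (C : U →L[ℂ] Y) (H : ℂ → U →L[ℂ] Y), AnalyticOnNhd ℂ H {z | ‖z‖ ≤ 1} ∧
      ∀ w : ℂ, ‖w‖ ≤ 1 → G w = C + (w • 1 - α) ∘L H w := by
  obtain ⟨C, H, hH, h⟩ := exists_eq_add_sub_apply hG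
    (T := ContinuousLinearMap.compL ℂ U Y Y α) (fun s hs => by
      convert isUnit_compL (U := U) (expStable_iff.1 hα s hs) using 1
      ext A x
      simp)
  refine ⟨C, H, hH, fun w hw => (h w hw).trans ?_⟩
  ext x
  simp

theorem eq_zero_of_eq_sub_comp {C : U →L[ℂ] Y} {H : ℂ → U →L[ℂ] Y}
    (hH : AnalyticOnNhd ℂ H {z | ‖z‖ ≤ 1}) {α : Y →L[ℂ] Y} (hα : ExpStable α)
    (h : ∀ w : ℂ, ‖w‖ = 1 → C = (w • 1 - α) ∘L H w) : C = 0 := by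
  refine eq_zero_of_eq_sub_apply hH (T := ContinuousLinearMap.compL ℂ U Y Y α)
    (fun s hs => ?_) (fun w hw => (h w hw).trans ?_)
  · convert isUnit_compL (U := U) (expStable_iff_one_sub.1 hα s hs) using 1
    ext A x
    simp
  · ext x
    simp

/-- The Stein equation `Q = α₋ Q α₊ + M` with exponentially stable `α₋`, `α₊` is solvable: `Q` is
the value of `(1 - w α₋)⁻¹ M` at `w = α₊`, the variable acting from the right. -/
theorem exists_stein {αm : Y →L[ℂ] Y} {αp : X →L[ℂ] X} (hm : ExpStable αm) (hp : ExpStable αp)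
    (M : X →L[ℂ] Y) : ∃ Q : X →L[ℂ] Y, Q = αm ∘L Q ∘L αp + M := by
  have hN : AnalyticOnNhd ℂ (fun w : ℂ => Ring.inverse (1 - w • αm) ∘L M) {z | ‖z‖ ≤ 1} :=
    fun z hz => analyticAt_clm_comp
      (analyticAt_inverse_one_sub_smul _ (expStable_iff_one_sub.1 hm z hz)) analyticAt_const
  obtain ⟨Q, H, hH, h⟩ := exists_eq_add_comp_sub hN hp
  refine ⟨Q, ?_⟩
  have : M - (Q - αm ∘L Q ∘L αp) = 0 := by
    refine eq_zero_of_eq_comp_sub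
      (H := fun w => (1 - w • αm) ∘L H w - αm ∘L Q) (fun z hz => ?_) hp (fun w hw => ?_)
    · exact (analyticAt_clm_comp (by fun_prop) (hH z hz)).sub analyticAt_const
    · ext x
      have h1 := congrArg (fun A : X →L[ℂ] Y => (1 - w • αm) (A x)) (h w hw.le)
      simp only [ContinuousLinearMap.comp_apply,
        apply_inverse_apply (expStable_iff_one_sub.1 hm w hw.le)] at h1
      simp only [sub_apply, ContinuousLinearMap.comp_apply, h1]
      simp
      module
  rw [sub_eq_zero] at this
  rw [this]
  abel

theorem stein_unique {αm : Y →L[ℂ] Y} {αp : X →L[ℂ] X} (hm : ExpStable αm) (hp : ExpStable αp)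
    {Q : X →L[ℂ] Y} (hQ : Q = αm ∘L Q ∘L αp) : Q = 0 := by
  have h0 : Q ∘L αp = 0 := by
    refine eq_zero_of_eq_comp_sub
      (H := fun w => -(Ring.inverse (1 - w • αm) ∘L Q)) (fun z hz => ?_) hp (fun w hw => ?_)
    · exact (analyticAt_clm_comp (analyticAt_inverse_one_sub_smul _
        (expStable_iff_one_sub.1 hm z hz)) analyticAt_const).neg
    · ext x
      have hu := expStable_iff_one_sub.1 hm w hw.le
      have h1 : (1 - w • αm) (Q (αp x)) = -(Q ((w • 1 - αp) x)) := by
        have h2 := congrArg (fun A : X →L[ℂ] Y => A x) hQ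
        simp only [ContinuousLinearMap.comp_apply] at h2
        simp [← h2]
      have h3 := inverse_apply_apply hu (Q (αp x))
      rw [h1, map_neg] at h3
      exact h3.symm
  rw [hQ, h0, ContinuousLinearMap.comp_zero]

end Division

/-! ### Algebra of the Riccati equation -/

section Riccati

variable {U Xp Xm : Type*}
  [NormedAddCommGroup U] [InnerProductSpace ℂ U]
  [NormedAddCommGroup Xp] [InnerProductSpace ℂ Xp]
  [NormedAddCommGroup Xm] [InnerProductSpace ℂ Xm]

/-- The product of the two factors, the Stein equation `Q = α₋ Q α₊ + B C` being used to separate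
`(z - α₋)⁻¹ B C (1 - z α₊)⁻¹` into partial fractions. -/
theorem mul_eq_eval (S : RepData U Xp Xm) {Q : Xp →L[ℂ] Xm} {B : U →L[ℂ] Xm} {C : Xp →L[ℂ] U}
    {δm δp : U →L[ℂ] U} (hδ : δm * δp = S.pivot Q) (hC : δm ∘L C = S.gq Q)
    (hB : B ∘L δp = S.bq Q) (hQ : Q = S.αm ∘L Q ∘L S.αp + B ∘L C) {z : ℂ}
    (hp : IsUnit (1 - z • S.αp)) (hm : IsUnit (z • 1 - S.αm)) :
    (δm + S.γm ∘L Ring.inverse (z • 1 - S.αm) ∘L B) *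
      (δp + z • (C ∘L Ring.inverse (1 - z • S.αp) ∘L S.βp)) = S.eval z := by
  ext x
  have hy := apply_inverse_apply hp (S.βp x)
  set y := Ring.inverse (1 - z • S.αp) (S.βp x) with hy_def
  have hM := inverse_apply_apply hm (Q y)
  have hδx := congrArg (fun A : U →L[ℂ] U => A x) hδ
  have hCy := congrArg (fun A : Xp →L[ℂ] U => A y) hC
  have hBx := congrArg (fun A : U →L[ℂ] Xm => A x) hB
  have hQy := congrArg (fun A : Xp →L[ℂ] Xm => A y) hQ
  simp only [RepData.pivot, RepData.gq, RepData.bq, mul_apply_eq_comp, sub_apply, add_apply,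
    smul_apply, one_apply_eq_self, ContinuousLinearMap.comp_apply] at hy hM hδx hCy hBx hQy
  have hβ : S.βp x = y - z • S.αp y := hy.symm
  have hBC : B (C y) = Q y - S.αm (Q (S.αp y)) := by rw [eq_sub_iff_add_eq', ← hQy]
  simp only [RepData.eval, mul_apply_eq_comp, add_apply, smul_apply,
    ContinuousLinearMap.comp_apply, ← hy_def, map_add, map_smul, hδx, hCy, hBx, hBC]
  simp only [map_sub, map_smul, hβ] at hM ⊢
  have hM' := congrArg S.γm hM
  rw [map_sub, map_smul, sub_eq_iff_eq_add] at hM'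
  simp only [smul_add, smul_sub, hM']
  module

/-- The difference of two solutions of the Riccati equation solves a homogeneous Stein equation. -/
theorem sub_eq_circ_comp_sub_comp_circ (S : RepData U Xp Xm) {Q Q' : Xp →L[ℂ] Xm}
    (hQ : S.SolvesRiccati Q) (hQ' : S.SolvesRiccati Q') :
    Q - Q' = S.αmCirc Q ∘L (Q - Q') ∘L S.αpCirc Q' := by
  ext x
  have h := congrArg (fun A : Xp →L[ℂ] Xm => A x) hQ.eqn
  have h' := congrArg (fun A : Xp →L[ℂ] Xm => A x) hQ'.eqn
  simp only [add_apply, ContinuousLinearMap.comp_apply] at h h'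
  set g := S.gq Q x with hg
  set g' := S.gq Q' x with hg'
  set v := Ring.inverse (S.pivot Q') g' with hv
  -- The differences of the coefficients are `γ₋ (Q - Q') α₊`, `α₋ (Q - Q') β₊` and
  -- `γ₋ (Q - Q') β₊`.
  set D := Q - Q' with hD
  have h1 : S.γm (D (S.αp x)) = g' - g := by
    simp [hD, hg, hg', RepData.gq]
  have h2 : S.αm (D (S.βp v)) = S.bq Q' v - S.bq Q v := by
    simp [hD, RepData.bq]
  have h3 : S.γm (D (S.βp v)) = g' - S.pivot Q v := by
    have : S.pivot Q' v = g' := apply_inverse_apply hQ'.isUnit_pivot g'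
    rw [← this]
    simp [hD, RepData.pivot]
  have h4 := inverse_apply_apply hQ.isUnit_pivot v
  have h5 : S.αm (D (S.αp x)) = S.αm (Q (S.αp x)) - S.αm (Q' (S.αp x)) := by simp [hD]
  have h0 : D x = S.αm (Q (S.αp x)) + S.bq Q (Ring.inverse (S.pivot Q) g) -
      (S.αm (Q' (S.αp x)) + S.bq Q' v) := by rw [hD, sub_apply, h, h']
  rw [h0]
  simp only [RepData.αmCirc, RepData.αpCirc, sub_apply, ContinuousLinearMap.comp_apply,
    ← hg', ← hv, map_sub, h1, h2, h3, h4, h5]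
  abel

variable [CompleteSpace Xm] in
theorem stabilizing_unique (S : RepData U Xp Xm) {Q Q' : Xp →L[ℂ] Xm}
    (hQ : S.IsStabilizing Q) (hQ' : S.IsStabilizing Q') : Q = Q' :=
  sub_eq_zero.1 (stein_unique hQ.stable_m hQ'.stable_p
    (sub_eq_circ_comp_sub_comp_circ S hQ.toSolvesRiccati hQ'.toSolvesRiccati))

theorem inverse_pivot_eq (S : RepData U Xp Xm) {Q : Xp →L[ℂ] Xm} {δm δp : U →L[ℂ] U}
    (hm : IsUnit δm) (hp : IsUnit δp) (hδ : δm * δp = S.pivot Q) :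
    IsUnit (S.pivot Q) ∧
      Ring.inverse (S.pivot Q) = Ring.inverse δp ∘L Ring.inverse δm := by
  rw [← hδ]
  refine inverse_eq_of_mul_eq_one ?_ ?_
  · ext x
    simp [apply_inverse_apply hm, apply_inverse_apply hp]
  · ext x
    simp [inverse_apply_apply hm, inverse_apply_apply hp]

end Riccati

/-! ### The factors built from a solution of the Riccati equation -/

section Factors

variable {U Xp Xm : Type*}
  [NormedAddCommGroup U] [InnerProductSpace ℂ U]
  [NormedAddCommGroup Xp] [InnerProductSpace ℂ Xp]
  [NormedAddCommGroup Xm] [InnerProductSpace ℂ Xm]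
  (S : RepData U Xp Xm) {Q : Xp →L[ℂ] Xm} {δm δp : U →L[ℂ] U}

theorem comp_γpCirc (hm : IsUnit δm) : δm ∘L S.γpCirc Q δm = S.gq Q := by
  ext x
  simp [RepData.γpCirc, apply_inverse_apply hm]

theorem βmCirc_comp (hp : IsUnit δp) : S.βmCirc Q δp ∘L δp = S.bq Q := by
  ext x
  simp [RepData.βmCirc, inverse_apply_apply hp]

/-- In terms of the coefficients of the factors, the Riccati equation is the Stein equation
`Q = α₋ Q α₊ + β₋° γ₊°`. -/
theorem solvesRiccati_iff_stein (hm : IsUnit δm) (hp : IsUnit δp) (hδ : δm * δp = S.pivot Q) :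
    S.SolvesRiccati Q ↔ Q = S.αm ∘L Q ∘L S.αp + S.βmCirc Q δp ∘L S.γpCirc Q δm := by
  obtain ⟨hu, hinv⟩ := inverse_pivot_eq S hm hp hδ
  have h : S.bq Q ∘L Ring.inverse (S.pivot Q) ∘L S.gq Q = S.βmCirc Q δp ∘L S.γpCirc Q δm := by
    rw [hinv]
    rfl
  exact ⟨fun hQ => h ▸ hQ.eqn, fun hQ => ⟨hu, h ▸ hQ⟩⟩

theorem αpCirc_eq (hm : IsUnit δm) (hp : IsUnit δp) (hδ : δm * δp = S.pivot Q) :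
    S.αpCirc Q = S.αp - S.βp ∘L Ring.inverse δp ∘L S.γpCirc Q δm := by
  rw [RepData.αpCirc, (inverse_pivot_eq S hm hp hδ).2]
  rfl

theorem αmCirc_eq (hm : IsUnit δm) (hp : IsUnit δp) (hδ : δm * δp = S.pivot Q) :
    S.αmCirc Q = S.αm - S.βmCirc Q δp ∘L Ring.inverse δm ∘L S.γm := by
  rw [RepData.αmCirc, (inverse_pivot_eq S hm hp hδ).2]
  rfl

theorem one_sub_smul_αpCirc (hm : IsUnit δm) (hp : IsUnit δp) (hδ : δm * δp = S.pivot Q) (z : ℂ) :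
    1 - z • S.αpCirc Q =
      (1 - z • S.αp) + S.βp ∘L Ring.inverse δp ∘L (z • S.γpCirc Q δm) := by
  rw [αpCirc_eq S hm hp hδ]
  ext x
  simp [smul_sub]
  abel

theorem smul_one_sub_αmCirc (hm : IsUnit δm) (hp : IsUnit δp) (hδ : δm * δp = S.pivot Q) (z : ℂ) :
    z • 1 - S.αmCirc Q =
      (z • 1 - S.αm) + S.βmCirc Q δp ∘L Ring.inverse δm ∘L S.γm := by
  rw [αmCirc_eq S hm hp hδ]
  abel

theorem Vp_eq (z : ℂ) : S.Vp Q δm δp z =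
    δp + (z • S.γpCirc Q δm) ∘L Ring.inverse (1 - z • S.αp) ∘L S.βp := by
  rw [RepData.Vp, ContinuousLinearMap.smul_comp]

theorem isUnit_Vp (hm : IsUnit δm) (hp : IsUnit δp) (hδ : δm * δp = S.pivot Q) {z : ℂ}
    (h1 : IsUnit (1 - z • S.αp)) (h2 : IsUnit (1 - z • S.αpCirc Q)) :
    IsUnit (S.Vp Q δm δp z) ∧ Ring.inverse (S.Vp Q δm δp z) = S.VpInv Q δm δp z := by
  have h3 := one_sub_smul_αpCirc S hm hp hδ z
  rw [h3] at h2
  obtain ⟨hu, hi⟩ := isUnit_add_comp_inverse h1 hp h2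
  rw [Vp_eq]
  refine ⟨hu, hi.trans ?_⟩
  rw [← h3]
  ext x
  simp [RepData.VpInv]

theorem isUnit_Vm (hm : IsUnit δm) (hp : IsUnit δp) (hδ : δm * δp = S.pivot Q) {z : ℂ}
    (h1 : IsUnit (z • 1 - S.αm)) (h2 : IsUnit (z • 1 - S.αmCirc Q)) :
    IsUnit (S.Vm Q δm δp z) ∧ Ring.inverse (S.Vm Q δm δp z) = S.VmInv Q δm δp z := by
  have h3 := smul_one_sub_αmCirc S hm hp hδ z
  rw [h3] at h2
  obtain ⟨hu, hi⟩ := isUnit_add_comp_inverse h1 hm h2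
  refine ⟨hu, hi.trans ?_⟩
  rw [← h3]
  rfl

theorem isUnit_one_sub_smul_αpCirc (hm : IsUnit δm) (hp : IsUnit δp) (hδ : δm * δp = S.pivot Q)
    {z : ℂ} (h1 : IsUnit (1 - z • S.αp)) (h2 : IsUnit (S.Vp Q δm δp z)) :
    IsUnit (1 - z • S.αpCirc Q) := by
  rw [Vp_eq] at h2
  rw [one_sub_smul_αpCirc S hm hp hδ z]
  exact (isUnit_add_comp_inverse hp h1 h2).1

theorem isUnit_smul_one_sub_αmCirc (hm : IsUnit δm) (hp : IsUnit δp) (hδ : δm * δp = S.pivot Q)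
    {z : ℂ} (h1 : IsUnit (z • 1 - S.αm)) (h2 : IsUnit (S.Vm Q δm δp z)) :
    IsUnit (z • 1 - S.αmCirc Q) := by
  rw [smul_one_sub_αmCirc S hm hp hδ z]
  exact (isUnit_add_comp_inverse hm h1 h2).1

end Factors

/-! ### The point at infinity -/

section Infinity

variable {U : Type*} [NormedAddCommGroup U] [InnerProductSpace ℂ U]

theorem analyticAtInfinity_inverse [CompleteSpace U] {V : ℂ → U →L[ℂ] U} {D : U →L[ℂ] U}
    (h : AnalyticAtInfinity V D) (hD : IsUnit D) :
    AnalyticAtInfinity (fun z => Ring.inverse (V z)) (Ring.inverse D) := by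
  have h1 := analyticAt_ringInverse h (by simpa using hD)
  refine h1.congr (Filter.Eventually.of_forall fun w => ?_)
  by_cases hw : w = 0
  · subst hw; simp
  · simp [hw]

/-- In the coordinate `w = 1 / z`, a function analytic on the closed exterior of the disc, including
`∞`, is analytic on the closed disc. -/
theorem analyticOnNhd_update {E : Type*} [NormedAddCommGroup E] [NormedSpace ℂ E]
    {V : ℂ → E} {D : E} (hV : AnalyticOnNhd ℂ V {z | 1 ≤ ‖z‖}) (h : AnalyticAtInfinity V D) :
    AnalyticOnNhd ℂ (Function.update (fun w : ℂ => V w⁻¹) 0 D) {z | ‖z‖ ≤ 1} := by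
  intro w hw
  by_cases hw0 : w = 0
  · subst hw0
    exact h
  · have h1 : 1 ≤ ‖w⁻¹‖ := by
      rw [norm_inv]
      exact (one_le_inv₀ (norm_pos_iff.2 hw0)).2 hw
    refine AnalyticAt.congr (AnalyticAt.fun_comp (g := V) (hV _ h1) (analyticAt_inv hw0)) ?_
    filter_upwards [isOpen_ne.mem_nhds hw0] with v hv
    simp [Function.update_of_ne hv]

end Infinity

/-! ### Factorizations from stabilizing solutions -/

section Sufficiency

variable {U Xp Xm : Type*}
  [NormedAddCommGroup U] [InnerProductSpace ℂ U] [CompleteSpace U]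
  [NormedAddCommGroup Xp] [InnerProductSpace ℂ Xp] [CompleteSpace Xp]
  [NormedAddCommGroup Xm] [InnerProductSpace ℂ Xm] [CompleteSpace Xm]
  {R : ℂ → U →L[ℂ] U} {S : RepData U Xp Xm}

/-- The factors built from a stabilizing solution have invertible values by Schur complements: the
state operators of their inverses are `α₊°` and `α₋°`. -/
theorem isRightCanonicalWH (hS : S.IsStableRepOf R) {Q : Xp →L[ℂ] Xm} (hQ : S.IsStabilizing Q)
    {δm δp : U →L[ℂ] U} (hm : IsUnit δm) (hp : IsUnit δp) (hδ : δm * δp = S.pivot Q) :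
    IsRightCanonicalWH R (S.Vm Q δm δp) (S.Vp Q δm δp) := by
  have hup := expStable_iff_one_sub.1 hS.stable_p
  have hum := expStable_iff.1 hS.stable_m
  have hVp : AnalyticOnNhd ℂ (S.Vp Q δm δp) {z | ‖z‖ ≤ 1} := fun z hz =>
    analyticAt_const.add (analyticAt_id.smul (analyticAt_clm_comp analyticAt_const
      (analyticAt_clm_comp (analyticAt_inverse_one_sub_smul _ (hup z hz)) analyticAt_const)))
  have hVm : AnalyticOnNhd ℂ (S.Vm Q δm δp) {z | 1 ≤ ‖z‖} := fun z hz =>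
    analyticAt_const.add (analyticAt_clm_comp analyticAt_const
      (analyticAt_clm_comp (analyticAt_inverse_smul_one_sub _ (hum z hz)) analyticAt_const))
  have huVp : ∀ z : ℂ, ‖z‖ ≤ 1 → IsUnit (S.Vp Q δm δp z) := fun z hz =>
    (isUnit_Vp S hm hp hδ (hup z hz) (expStable_iff_one_sub.1 hQ.stable_p z hz)).1
  have huVm : ∀ z : ℂ, 1 ≤ ‖z‖ → IsUnit (S.Vm Q δm δp z) := fun z hz =>
    (isUnit_Vm S hm hp hδ (hum z hz) (expStable_iff.1 hQ.stable_m z hz)).1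
  have hinf : AnalyticAtInfinity (S.Vm Q δm δp) δm := by
    have h1 : AnalyticAt ℂ (fun w : ℂ => δm + w • (S.γm ∘L Ring.inverse (1 - w • S.αm) ∘L
        S.βmCirc Q δp)) 0 :=
      analyticAt_const.add (analyticAt_id.smul (analyticAt_clm_comp analyticAt_const
        (analyticAt_clm_comp (analyticAt_inverse_one_sub_smul _ (by simp)) analyticAt_const)))
    refine h1.congr ?_
    filter_upwards [Metric.ball_mem_nhds (0 : ℂ) one_pos] with w hw
    by_cases hw0 : w = 0
    · subst hw0
      simp
    · have hu : IsUnit (1 - (w⁻¹)⁻¹ • S.αm) := by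
        rw [inv_inv]
        exact expStable_iff_one_sub.1 hS.stable_m w (mem_ball_zero_iff.1 hw).le
      rw [Function.update_of_ne hw0, RepData.Vm, inverse_smul_one_sub (inv_ne_zero hw0) hu, inv_inv,
        ContinuousLinearMap.smul_comp, ContinuousLinearMap.comp_smul]
  refine ⟨?_, hVp, huVp, fun z hz => analyticAt_ringInverse (hVp z hz) (huVp z hz), hVm, huVm,
    fun z hz => analyticAt_ringInverse (hVm z hz) (huVm z hz),
    δm, hm, hinf, analyticAtInfinity_inverse hinf hm⟩
  rw [eventually_nhdsSet_iff_forall]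
  intro z hz
  have hz1 : ‖z‖ = 1 := by simpa using hz
  have e1 : ∀ᶠ w in 𝓝 z, IsUnit (1 - w • S.αp) :=
    eventually_isUnit (f := fun w : ℂ => 1 - w • S.αp) (by fun_prop) (hup z hz1.le)
  have e2 : ∀ᶠ w in 𝓝 z, IsUnit (w • 1 - S.αm) :=
    eventually_isUnit (f := fun w : ℂ => w • 1 - S.αm) (by fun_prop) (hum z hz1.ge)
  filter_upwards [e1, e2, eventually_nhdsSet_iff_forall.1 hS.eq_eval z hz] with w h1 h2 h3
  rw [h3]
  exact (mul_eq_eval S hδ (comp_γpCirc S hm) (βmCirc_comp S hp)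
    ((solvesRiccati_iff_stein S hm hp hδ).1 hQ.toSolvesRiccati) h1 h2).symm

end Sufficiency

/-! ### Stabilizing solutions from factorizations -/

section Necessity

variable {U Xp Xm : Type*}
  [NormedAddCommGroup U] [InnerProductSpace ℂ U] [CompleteSpace U]
  [NormedAddCommGroup Xp] [InnerProductSpace ℂ Xp]
  [NormedAddCommGroup Xm] [InnerProductSpace ℂ Xm] [CompleteSpace Xm]
  (S : RepData U Xp Xm)

/-- The value of `G(w) γ₊` at `w = α₊` is `V₋(∞)⁻¹ (γ₊ - γ₋ Q α₊)`. Here `W w = V₋(1 / w)` and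
`G` is its inverse; multiplying the division formula for `G(w) γ₊` by `W w` turns it into one for
`γ₊` itself, and remainders are unique. -/
theorem minus_value_comp (hp : ExpStable S.αp) (hm : ExpStable S.αm) {W G : ℂ → U →L[ℂ] U}
    {B : U →L[ℂ] Xm} {C : Xp →L[ℂ] U} {Q : Xp →L[ℂ] Xm}
    (hQ : Q = S.αm ∘L Q ∘L S.αp + B ∘L C)
    (hW : AnalyticOnNhd ℂ W {z | ‖z‖ ≤ 1}) (hWG : ∀ w : ℂ, ‖w‖ ≤ 1 → W w * G w = 1)
    (hWB : ∀ w : ℂ, ‖w‖ ≤ 1 → W w = W 0 + w • (S.γm ∘L Ring.inverse (1 - w • S.αm) ∘L B))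
    {H : ℂ → Xp →L[ℂ] U} (hH : AnalyticOnNhd ℂ H {z | ‖z‖ ≤ 1})
    (hC : ∀ w : ℂ, ‖w‖ ≤ 1 → G w ∘L S.γp = C + H w ∘L (w • 1 - S.αp)) :
    W 0 ∘L C = S.gq Q := by
  have hum := expStable_iff_one_sub.1 hm
  have h0 : S.gq Q - W 0 ∘L C = 0 := by
    refine eq_zero_of_eq_comp_sub (H := fun w => W w ∘L H w +
      S.γm ∘L Ring.inverse (1 - w • S.αm) ∘L Q) (fun w hw => ?_) hp (fun w hw => ?_)
    · exact (analyticAt_clm_comp (hW w hw) (hH w hw)).add (analyticAt_clm_comp analyticAt_const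
        (analyticAt_clm_comp (analyticAt_inverse_one_sub_smul _ (hum w hw)) analyticAt_const))
    · ext x
      have hQx := congrArg (fun A : Xp →L[ℂ] Xm => A x) hQ
      simp only [add_apply, ContinuousLinearMap.comp_apply] at hQx
      -- `w B C = (1 - w α₋) Q α₊ + Q (w - α₊)`.
      have h1 : w • B (C x) =
          (1 - w • S.αm : Xm →L[ℂ] Xm) (Q (S.αp x)) + Q ((w • 1 - S.αp : Xp →L[ℂ] Xp) x) := by
        have : B (C x) = Q x - S.αm (Q (S.αp x)) := by rw [eq_sub_iff_add_eq', ← hQx]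
        rw [this]
        simp [smul_sub]
      have h2 := congrArg (⇑(Ring.inverse (1 - w • S.αm))) h1
      rw [map_add, map_smul, inverse_apply_apply (hum w hw.le)] at h2
      have h3 := congrArg (fun A : Xp →L[ℂ] U => W w (A x)) (hC w hw.le)
      have h4 : W w (G w (S.γp x)) = S.γp x :=
        congrArg (fun A : U →L[ℂ] U => A (S.γp x)) (hWG w hw.le)
      have h5 := congrArg (fun A : U →L[ℂ] U => A (C x)) (hWB w hw.le)
      simp only [add_apply, smul_apply, ContinuousLinearMap.comp_apply] at h3 h5
      rw [← map_smul, h2, map_add] at h5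
      rw [h4, map_add, h5] at h3
      simp only [RepData.gq, add_apply, sub_apply (S.γp - S.γm ∘L Q ∘L S.αp),
        sub_apply S.γp, ContinuousLinearMap.comp_apply]
      conv_lhs => rw [h3]
      abel
  exact (sub_eq_zero.1 h0).symm

variable [CompleteSpace Xp]

/-- The plus factor is `V₊(0) + z C (1 - z α₊)⁻¹ β₊`, where `C` is the value of `G(w) γ₊` at
`w = α₊` and `G(1 / z)` is the inverse of the minus factor: the difference
`V₊(z) - z C (1 - z α₊)⁻¹ β₊` continues analytically to the exterior of the disc. -/
theorem plus_factor_eq (hp : ExpStable S.αp) (hm : ExpStable S.αm) {Vp G : ℂ → U →L[ℂ] U}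
    (hVp : AnalyticOnNhd ℂ Vp {z | ‖z‖ ≤ 1}) (hG : AnalyticOnNhd ℂ G {z | ‖z‖ ≤ 1})
    (hfac : ∀ z : ℂ, ‖z‖ = 1 → Vp z = G z⁻¹ * S.eval z)
    {C : Xp →L[ℂ] U} {H : ℂ → Xp →L[ℂ] U} (hH : AnalyticOnNhd ℂ H {z | ‖z‖ ≤ 1})
    (hC : ∀ w : ℂ, ‖w‖ ≤ 1 → G w ∘L S.γp = C + H w ∘L (w • 1 - S.αp)) {z : ℂ} (hz : ‖z‖ ≤ 1) :
    Vp z = Vp 0 + z • (C ∘L Ring.inverse (1 - z • S.αp) ∘L S.βp) := by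
  have hup := expStable_iff_one_sub.1 hp
  have hum := expStable_iff_one_sub.1 hm
  have hf : AnalyticOnNhd ℂ (fun z : ℂ =>
      Vp z - z • (C ∘L Ring.inverse (1 - z • S.αp) ∘L S.βp)) {z | ‖z‖ ≤ 1} := fun z hz =>
    (hVp z hz).sub (analyticAt_id.smul (analyticAt_clm_comp analyticAt_const
      (analyticAt_clm_comp (analyticAt_inverse_one_sub_smul _ (hup z hz)) analyticAt_const)))
  have hg : AnalyticOnNhd ℂ (fun w : ℂ => G w ∘L S.δ + H w ∘L S.βp +
      w • (G w ∘L S.γm ∘L Ring.inverse (1 - w • S.αm) ∘L S.βm)) {z | ‖z‖ ≤ 1} := fun w hw =>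
    ((analyticAt_clm_comp (hG w hw) analyticAt_const).add
      (analyticAt_clm_comp (hH w hw) analyticAt_const)).add
      (analyticAt_id.smul (analyticAt_clm_comp (hG w hw) (analyticAt_clm_comp analyticAt_const
        (analyticAt_clm_comp (analyticAt_inverse_one_sub_smul _ (hum w hw)) analyticAt_const))))
  have h := (eq_const_of_eqOn_circle hf hg ?_).1 z hz
  · simpa [sub_eq_iff_eq_add] using h
  intro z hz
  have hz0 : z ≠ 0 := by rintro rfl; norm_num at hz
  have hw1 : ‖z⁻¹‖ = 1 := by rw [norm_inv, hz, inv_one]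
  ext x
  have hy := apply_inverse_apply (hup z hz.le) (S.βp x)
  set y := Ring.inverse (1 - z • S.αp) (S.βp x) with hy_def
  simp only [sub_apply, one_apply_eq_self, smul_apply] at hy
  have hCy := congrArg (fun A : Xp →L[ℂ] U => z • A y) (hC z⁻¹ hw1.le)
  simp only [add_apply, sub_apply, smul_apply, one_apply_eq_self, ContinuousLinearMap.comp_apply,
    map_sub, map_smul, smul_add, smul_sub, smul_inv_smul₀ hz0] at hCy
  rw [hfac z hz, RepData.eval, inverse_smul_one_sub hz0 (hum z⁻¹ hw1.le)]
  simp only [add_apply, sub_apply, smul_apply, ContinuousLinearMap.comp_apply, mul_apply_eq_comp,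
    map_add, map_smul, ← hy_def, hCy]
  rw [← hy, map_sub, map_smul]
  abel

/-- The minus factor is `V₋(∞) + γ₋ (z - α₋)⁻¹ B`, where `B` is the value of `β₋ V₊(z)⁻¹` at
`z = α₋`; here `W w = V₋(1 / w)`. -/
theorem minus_factor_eq (hp : ExpStable S.αp) (hm : ExpStable S.αm) {W K : ℂ → U →L[ℂ] U}
    (hW : AnalyticOnNhd ℂ W {z | ‖z‖ ≤ 1}) (hK : AnalyticOnNhd ℂ K {z | ‖z‖ ≤ 1})
    (hfac : ∀ z : ℂ, ‖z‖ = 1 → W z⁻¹ = S.eval z * K z)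
    {B : U →L[ℂ] Xm} {H : ℂ → U →L[ℂ] Xm} (hH : AnalyticOnNhd ℂ H {z | ‖z‖ ≤ 1})
    (hB : ∀ z : ℂ, ‖z‖ ≤ 1 → S.βm ∘L K z = B + (z • 1 - S.αm) ∘L H z) {w : ℂ} (hw : ‖w‖ ≤ 1) :
    W w = W 0 + w • (S.γm ∘L Ring.inverse (1 - w • S.αm) ∘L B) := by
  have hup := expStable_iff_one_sub.1 hp
  have hum := expStable_iff_one_sub.1 hm
  have hg : AnalyticOnNhd ℂ (fun w : ℂ =>
      W w - w • (S.γm ∘L Ring.inverse (1 - w • S.αm) ∘L B)) {z | ‖z‖ ≤ 1} := fun z hz =>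
    (hW z hz).sub (analyticAt_id.smul (analyticAt_clm_comp analyticAt_const
      (analyticAt_clm_comp (analyticAt_inverse_one_sub_smul _ (hum z hz)) analyticAt_const)))
  have hf : AnalyticOnNhd ℂ (fun z : ℂ => S.δ ∘L K z +
      z • (S.γp ∘L Ring.inverse (1 - z • S.αp) ∘L S.βp ∘L K z) + S.γm ∘L H z)
      {z | ‖z‖ ≤ 1} := fun z hz =>
    ((analyticAt_clm_comp analyticAt_const (hK z hz)).add
      (analyticAt_id.smul (analyticAt_clm_comp analyticAt_const (analyticAt_clm_comp
        (analyticAt_inverse_one_sub_smul _ (hup z hz))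
        (analyticAt_clm_comp analyticAt_const (hK z hz)))))).add
      (analyticAt_clm_comp analyticAt_const (hH z hz))
  have h := (eq_const_of_eqOn_circle hf hg ?_).2
  · have h1 := (h w hw).trans (h 0 (by simp)).symm
    simpa [sub_eq_iff_eq_add] using h1
  intro z hz
  have hz0 : z ≠ 0 := by rintro rfl; norm_num at hz
  have hw1 : ‖z⁻¹‖ = 1 := by rw [norm_inv, hz, inv_one]
  ext x
  have hB' := congrArg (fun A : U →L[ℂ] Xm => Ring.inverse (z • 1 - S.αm) (A x)) (hB z hz.le)
  simp only [add_apply, ContinuousLinearMap.comp_apply, map_add,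
    inverse_apply_apply (expStable_iff.1 hm z hz.ge)] at hB'
  rw [hfac z hz, RepData.eval]
  simp only [add_apply, sub_apply, smul_apply, ContinuousLinearMap.comp_apply, mul_apply_eq_comp,
    hB', map_add]
  rw [inverse_smul_one_sub hz0 (hum z⁻¹ hw1.le)]
  simp only [smul_apply, map_smul]
  abel

/-- The value of `β₋ V₊(z)⁻¹` at `z = α₋` is `(β₋ - α₋ Q β₊) V₊(0)⁻¹`. -/
theorem comp_plus_value (hp : ExpStable S.αp) (hm : ExpStable S.αm) {Vp K : ℂ → U →L[ℂ] U}
    {B : U →L[ℂ] Xm} {C : Xp →L[ℂ] U} {Q : Xp →L[ℂ] Xm}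
    (hQ : Q = S.αm ∘L Q ∘L S.αp + B ∘L C)
    (hVp : AnalyticOnNhd ℂ Vp {z | ‖z‖ ≤ 1}) (hKV : ∀ z : ℂ, ‖z‖ ≤ 1 → K z * Vp z = 1)
    (hVC : ∀ z : ℂ, ‖z‖ ≤ 1 → Vp z = Vp 0 + z • (C ∘L Ring.inverse (1 - z • S.αp) ∘L S.βp))
    {H : ℂ → U →L[ℂ] Xm} (hH : AnalyticOnNhd ℂ H {z | ‖z‖ ≤ 1})
    (hB : ∀ z : ℂ, ‖z‖ ≤ 1 → S.βm ∘L K z = B + (z • 1 - S.αm) ∘L H z) :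
    B ∘L Vp 0 = S.bq Q := by
  have hup := expStable_iff_one_sub.1 hp
  have h0 : S.bq Q - B ∘L Vp 0 = 0 := by
    refine eq_zero_of_eq_sub_comp (H := fun z => H z ∘L Vp z +
      Q ∘L Ring.inverse (1 - z • S.αp) ∘L S.βp) (fun z hz => ?_) hm (fun z hz => ?_)
    · exact (analyticAt_clm_comp (hH z hz) (hVp z hz)).add (analyticAt_clm_comp analyticAt_const
        (analyticAt_clm_comp (analyticAt_inverse_one_sub_smul _ (hup z hz)) analyticAt_const))
    · ext x
      have hy := apply_inverse_apply (hup z hz.le) (S.βp x)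
      set y := Ring.inverse (1 - z • S.αp) (S.βp x) with hy_def
      have hQy := congrArg (fun A : Xp →L[ℂ] Xm => A y) hQ
      simp only [add_apply, ContinuousLinearMap.comp_apply] at hQy
      -- `z B C = α₋ Q (1 - z α₊) + (z - α₋) Q`.
      have h1 : z • B (C y) = S.αm (Q (S.βp x)) + (z • 1 - S.αm : Xm →L[ℂ] Xm) (Q y) := by
        have : B (C y) = Q y - S.αm (Q (S.αp y)) := by rw [eq_sub_iff_add_eq', ← hQy]
        rw [this, ← hy]
        simp [smul_sub]
      have h3 := congrArg (fun A : U →L[ℂ] Xm => A (Vp z x)) (hB z hz.le)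
      have h4 : K z (Vp z x) = x := congrArg (fun A : U →L[ℂ] U => A x) (hKV z hz.le)
      have h5 := congrArg (fun A : U →L[ℂ] U => B (A x)) (hVC z hz.le)
      simp only [add_apply, smul_apply, ContinuousLinearMap.comp_apply, ← hy_def] at h3 h5
      rw [map_add, map_smul, h1] at h5
      rw [h4, h5] at h3
      simp only [RepData.bq, add_apply, sub_apply (S.βm - S.αm ∘L Q ∘L S.βp),
        sub_apply S.βm, ContinuousLinearMap.comp_apply, map_add, ← hy_def]
      conv_lhs => rw [h3]
      abel
  exact (sub_eq_zero.1 h0).symm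

/-- A right canonical factorization yields the stabilizing solution as the solution of the Stein
equation `Q = α₋ Q α₊ + B C`, where `B` and `C` are the coefficients of the two factors. -/
theorem exists_isStabilizing {R Vm Vp : ℂ → U →L[ℂ] U} {S : RepData U Xp Xm}
    (hS : S.IsStableRepOf R) (hV : IsRightCanonicalWH R Vm Vp) :
    ∃ Q : Xp →L[ℂ] Xm, S.IsStabilizing Q := by
  obtain ⟨D, hD, hinf, hinf'⟩ := hV.minus_infinity
  have hsp := hS.stable_p
  have hsm := hS.stable_m
  have hW := analyticOnNhd_update hV.minus_analytic hinf
  have hG := analyticOnNhd_update hV.minus_inv_analytic hinf'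
  set W := Function.update (fun w : ℂ => Vm w⁻¹) 0 D with hWdef
  set G := Function.update (fun w : ℂ => Ring.inverse (Vm w⁻¹)) 0 (Ring.inverse D) with hGdef
  let K : ℂ → U →L[ℂ] U := fun z => Ring.inverse (Vp z)
  have hK : AnalyticOnNhd ℂ K {z | ‖z‖ ≤ 1} := hV.plus_inv_analytic
  have hKV : ∀ z : ℂ, ‖z‖ ≤ 1 → K z * Vp z = 1 := fun z hz =>
    Ring.inverse_mul_cancel _ (hV.plus_isUnit z hz)
  have hVK : ∀ z : ℂ, ‖z‖ ≤ 1 → Vp z * K z = 1 := fun z hz =>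
    Ring.mul_inverse_cancel _ (hV.plus_isUnit z hz)
  have hWu : ∀ w : ℂ, ‖w‖ ≤ 1 → IsUnit (W w) ∧ G w = Ring.inverse (W w) := by
    intro w hw
    by_cases hw0 : w = 0
    · subst hw0
      simpa [hWdef, hGdef] using hD
    · simp only [hWdef, hGdef, Function.update_of_ne hw0, and_true]
      refine hV.minus_isUnit _ ?_
      rw [norm_inv]
      exact (one_le_inv₀ (norm_pos_iff.2 hw0)).2 hw
  have hWG : ∀ w : ℂ, ‖w‖ ≤ 1 → W w * G w = 1 := fun w hw => by
    rw [(hWu w hw).2, Ring.mul_inverse_cancel _ (hWu w hw).1]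
  have hGW : ∀ w : ℂ, ‖w‖ ≤ 1 → G w * W w = 1 := fun w hw => by
    rw [(hWu w hw).2, Ring.inverse_mul_cancel _ (hWu w hw).1]
  have hWz : ∀ z : ℂ, z ≠ 0 → W z⁻¹ = Vm z := fun z hz => by
    simp [hWdef, hz]
  have hcirc : ∀ z : ℂ, ‖z‖ = 1 → S.eval z = W z⁻¹ * Vp z := by
    intro z hz
    have hz0 : z ≠ 0 := by rintro rfl; norm_num at hz
    have hzs : z ∈ Metric.sphere (0 : ℂ) 1 := by simpa using hz
    rw [hWz z hz0, ← hS.eq_eval.self_of_nhdsSet z hzs, hV.factor.self_of_nhdsSet z hzs]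
  have hinv1 : ∀ z : ℂ, ‖z‖ = 1 → ‖z⁻¹‖ ≤ 1 := fun z hz => by rw [norm_inv, hz, inv_one]
  obtain ⟨C, H, hH, hC⟩ := exists_eq_add_comp_sub
    (G := fun w => G w ∘L S.γp) (fun w hw => analyticAt_clm_comp (hG w hw) analyticAt_const) hsp
  obtain ⟨B, H', hH', hB⟩ := exists_eq_add_sub_comp
    (G := fun z => S.βm ∘L K z) (fun z hz => analyticAt_clm_comp analyticAt_const (hK z hz)) hsm
  obtain ⟨Q, hQ⟩ := exists_stein hsm hsp (B ∘L C)
  have hVC : ∀ z : ℂ, ‖z‖ ≤ 1 →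
      Vp z = Vp 0 + z • (C ∘L Ring.inverse (1 - z • S.αp) ∘L S.βp) := fun z hz =>
    plus_factor_eq S hsp hsm hV.plus_analytic hG
      (fun z hz => by rw [hcirc z hz, ← mul_assoc, hGW _ (hinv1 z hz), one_mul]) hH hC hz
  have hWB : ∀ w : ℂ, ‖w‖ ≤ 1 →
      W w = W 0 + w • (S.γm ∘L Ring.inverse (1 - w • S.αm) ∘L B) := fun w hw =>
    minus_factor_eq S hsp hsm hW hK
      (fun z hz => by rw [hcirc z hz, mul_assoc, hVK _ hz.le, mul_one]) hH' hB hw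
  have hWB' : ∀ z : ℂ, 1 ≤ ‖z‖ →
      Vm z = W 0 + S.γm ∘L Ring.inverse (z • 1 - S.αm) ∘L B := by
    intro z hz
    have hz0 : z ≠ 0 := by rintro rfl; norm_num at hz
    have hz1 : ‖z⁻¹‖ ≤ 1 := by rw [norm_inv]; exact inv_le_one_of_one_le₀ hz
    rw [← hWz z hz0, hWB _ hz1,
      inverse_smul_one_sub hz0 (expStable_iff_one_sub.1 hsm _ hz1),
      ContinuousLinearMap.smul_comp, ContinuousLinearMap.comp_smul]
  have hgq : W 0 ∘L C = S.gq Q := minus_value_comp S hsp hsm hQ hW hWG hWB hH hC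
  have hbq : B ∘L Vp 0 = S.bq Q := comp_plus_value S hsp hsm hQ hV.plus_analytic hKV hVC hH' hB
  have hm : IsUnit (W 0) := (hWu 0 (by simp)).1
  have hp : IsUnit (Vp 0) := hV.plus_isUnit 0 (by simp)
  -- The product formula determines the constant term of the representation, here at `z = 1`.
  have hδ : W 0 * Vp 0 = S.pivot Q := by
    let S' : RepData U Xp Xm := { S with δ := W 0 * Vp 0 + S.γm ∘L Q ∘L S.βp }
    have h1 : S'.eval 1 = S.eval 1 := by
      have h2 := mul_eq_eval S' (δm := W 0) (δp := Vp 0) (z := 1)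
        (by simp [S', RepData.pivot]) hgq hbq hQ
        (expStable_iff_one_sub.1 hsp 1 (by simp)) (expStable_iff.1 hsm 1 (by simp))
      rw [← h2, hcirc 1 (by simp), hWz 1 one_ne_zero, hWB' 1 (by simp), hVC 1 (by simp)]
    have h3 : W 0 * Vp 0 + S.γm ∘L Q ∘L S.βp = S.δ := by
      simpa [S', RepData.eval] using h1
    rw [RepData.pivot, ← h3, add_sub_cancel_right]
  have hCeq : S.γpCirc Q (W 0) = C := by
    rw [RepData.γpCirc, ← hgq]
    ext x
    simp [inverse_apply_apply hm]
  have hBeq : S.βmCirc Q (Vp 0) = B := by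
    rw [RepData.βmCirc, ← hbq]
    ext x
    simp [apply_inverse_apply hp]
  refine ⟨Q, (solvesRiccati_iff_stein S hm hp hδ).2 (by rwa [hCeq, hBeq]), ?_, ?_⟩
  · refine expStable_iff_one_sub.2 fun z hz => isUnit_one_sub_smul_αpCirc S hm hp hδ
      (expStable_iff_one_sub.1 hsp z hz) ?_
    rw [RepData.Vp, hCeq, ← hVC z hz]
    exact hV.plus_isUnit z hz
  · refine expStable_iff.2 fun z hz => isUnit_smul_one_sub_αmCirc S hm hp hδ
      (expStable_iff.1 hsm z hz) ?_
    rw [RepData.Vm, hBeq, ← hWB' z hz]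
    exact hV.minus_isUnit z hz

end Necessity

end WienerHopf

theorem theorem2p1
    {U Xp Xm : Type*}
    [NormedAddCommGroup U] [InnerProductSpace ℂ U] [CompleteSpace U]
    [NormedAddCommGroup Xp] [InnerProductSpace ℂ Xp] [CompleteSpace Xp]
    [NormedAddCommGroup Xm] [InnerProductSpace ℂ Xm] [CompleteSpace Xm]
    (R : ℂ → (U →L[ℂ] U)) (S : RepData U Xp Xm) (hS : S.IsStableRepOf R)
    (hR_analytic : AnalyticOnNhd ℂ R (Metric.sphere (0 : ℂ) 1))
    (hR_isUnit : ∀ᶠ z in 𝓝ˢ (Metric.sphere (0 : ℂ) 1), IsUnit (R z)) :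
    -- existence of a factorization is equivalent to existence of a stabilizing solution
    ((∃ Vm Vp : ℂ → (U →L[ℂ] U), IsRightCanonicalWH R Vm Vp) ↔
      ∃ Q : Xp →L[ℂ] Xm, S.IsStabilizing Q) ∧
    -- there is at most one stabilizing solution
    (∀ Q Q' : Xp →L[ℂ] Xm, S.IsStabilizing Q → S.IsStabilizing Q' → Q = Q') ∧
    -- explicit factors and their inverses
    (∀ Q : Xp →L[ℂ] Xm, S.IsStabilizing Q →
      ∀ δm δp : U →L[ℂ] U, IsUnit δm → IsUnit δp → δm * δp = S.pivot Q →
        IsRightCanonicalWH R (S.Vm Q δm δp) (S.Vp Q δm δp) ∧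
        -- the formulas for the factors and their inverses make sense on the closed disc and on
        -- the closed exterior, respectively
        (∀ z : ℂ, ‖z‖ ≤ 1 → IsUnit (1 - z • S.αp) ∧ IsUnit (1 - z • S.αpCirc Q)) ∧
        (∀ z : ℂ, 1 ≤ ‖z‖ → IsUnit (z • 1 - S.αm) ∧ IsUnit (z • 1 - S.αmCirc Q)) ∧
        (∀ z : ℂ, IsUnit (1 - z • S.αp) → IsUnit (1 - z • S.αpCirc Q) →
          IsUnit (S.Vp Q δm δp z) ∧
            Ring.inverse (S.Vp Q δm δp z) = S.VpInv Q δm δp z) ∧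
        (∀ z : ℂ, IsUnit (z • 1 - S.αm) → IsUnit (z • 1 - S.αmCirc Q) →
          IsUnit (S.Vm Q δm δp z) ∧
            Ring.inverse (S.Vm Q δm δp z) = S.VmInv Q δm δp z)) := by
  refine ⟨⟨fun ⟨Vm, Vp, hV⟩ => WienerHopf.exists_isStabilizing hS hV, fun ⟨Q, hQ⟩ => ?_⟩,
    fun Q Q' hQ hQ' => WienerHopf.stabilizing_unique S hQ hQ', ?_⟩
  · exact ⟨_, _, WienerHopf.isRightCanonicalWH hS hQ isUnit_one hQ.isUnit_pivot (one_mul _)⟩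
  · intro Q hQ δm δp hm hp hδ
    exact ⟨WienerHopf.isRightCanonicalWH hS hQ hm hp hδ,
      fun z hz => ⟨WienerHopf.expStable_iff_one_sub.1 hS.stable_p z hz,
        WienerHopf.expStable_iff_one_sub.1 hQ.stable_p z hz⟩,
      fun z hz => ⟨WienerHopf.expStable_iff.1 hS.stable_m z hz,
        WienerHopf.expStable_iff.1 hQ.stable_m z hz⟩,
      fun z => WienerHopf.isUnit_Vp S hm hp hδ, fun z => WienerHopf.isUnit_Vm S hm hp hδ⟩
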